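/- Setting. In round $t=0,1,\dots,T-1$ of a stochastic linear bandit on the closed Euclidean unit ball $\mathcal A\subset\mathbb R^{d+1}$, a (possibly randomized) algorithm draws an action $a_t\in\mathcal A$ from a probability distribution depending on the past actions and rewards (a Markov kernel), and receives the reward $y_t=\langle a_t,\theta^\star\rangle+\xi_t$, where the $1$-sub-Gaussian noise $\xi_t$ is independent of the past and of $a_t$. Put $a^\star=\theta^\star/\|\theta^\star\|$, $r(a,a')=\langle\theta^\star,a\rangle-\langle\theta^\star,a'\rangle$ and $\operatorname{Reg}^{\theta^\star}(T)=\sum_{t<T} r(a^\star,a_t)$. Theorem. Let $d,T\in\mathbb N$ with $T\ge\max(d^2/2^8,\,2^6)$, and let $\Delta\ge 0$ with $\Delta^2=\frac{d}{2^8\sqrt T}$. For every hint $h\in\mathbb R^{d+1}$ with $\|h\|=1$ and every algorithm, there is a linear bandit instance with parameter $\theta^\star\in\mathbb R^{d+1}$ (and with standard Gaussian noise in every round) such that \[ \Big\|\theta^\star-\frac h2\Big\|\le\Delta,\qquad \|a^\star-h\|\le 4\Delta,\qquad r(a^\star,h)=\langle\theta^\star,a^\star-h\rangle\le 972\,\Delta^2=\frac{243}{64}\cdot\frac{d}{\sqrt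 T}=O\!\left(\frac{d}{\sqrt T}\right), \] and, on this same instance, the expected regret of the algorithm satisfies \[ \mathbb E\big[\operatorname{Reg}^{\theta^\star}(T)\big]\ \ge\ \frac{d\sqrt T}{512}. \] -/

import Mathlib

open MeasureTheory ProbabilityTheory
open scoped RealInnerProductSpace

noncomputable section

namespace LinBandit

/-- The action set: the closed Euclidean unit ball of `ℝⁿ`. -/
abbrev Action (n : ℕ) : Type :=
  ↥(Metric.closedBall (0 : EuclideanSpace ℝ (Fin n)) 1)

/-- What the learner has seen after `t` rounds: the actions played and the rewards received. -/
abbrev History (n t : ℕ) : Type := Fin t → Action n × ℝ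

/-- A stochastic linear bandit instance on the unit ball of `ℝⁿ`: the parameter vector, and for each
round the law of the noise, which is `1`-sub-Gaussian (in particular centered). -/
structure Instance (n : ℕ) where
  θ : EuclideanSpace ℝ (Fin n)
  noise : ℕ → Measure ℝ
  noise_prob : ∀ t, IsProbabilityMeasure (noise t)
  noise_subGaussian : ∀ t, HasSubgaussianMGF (fun x : ℝ => x) 1 (noise t)

/-- A (possibly randomized) algorithm: given the history of the first `t` rounds, a probability
distribution on the actions from which the action of the next round is drawn. -/
structure Algorithm (n : ℕ) where
  policy : (t : ℕ) → Kernel (History n t) (Action n)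
  policy_markov : ∀ t, IsMarkovKernel (policy t)

attribute [instance] Instance.noise_prob Algorithm.policy_markov

/-- One round: the action `a` and the noise value `ξ` extend a history by the pair
`(a, ⟪a, θ⟫ + ξ)`. -/
def extend {n : ℕ} (θ : EuclideanSpace ℝ (Fin n)) (t : ℕ)
    (p : (History n t × Action n) × ℝ) : History n (t + 1) :=
  Fin.snoc (α := fun _ => Action n × ℝ) p.1.1
    (p.1.2, ⟪(p.1.2 : EuclideanSpace ℝ (Fin n)), θ⟫ + p.2)

lemma measurable_extend {n : ℕ} (θ : EuclideanSpace ℝ (Fin n)) (t : ℕ) :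
    Measurable (extend θ t) := by
  refine measurable_pi_lambda _ fun i => ?_
  refine Fin.lastCases ?_ (fun j => ?_) i
  · simp only [extend, Fin.snoc_last]
    fun_prop
  · simp only [extend, Fin.snoc_castSucc]
    fun_prop

/-- The law of the history of the first `t` rounds when the algorithm `alg` runs on the
instance `B`: in each round the action is drawn from the policy given the past, and the noise is
independent of the past and of the action. -/
def historyLaw {n : ℕ} (alg : Algorithm n) (B : Instance n) : (t : ℕ) → Measure (History n t)
  | 0 => Measure.dirac Fin.elim0
  | t + 1 =>
      (((historyLaw alg B t) ⊗ₘ (alg.policy t)).prod (B.noise t)).map (extend B.θ t)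

/-- The law of the history is a probability measure, so no operation in its definition takes a
default value. -/
instance isProbabilityMeasure_historyLaw {n : ℕ} (alg : Algorithm n) (B : Instance n) (t : ℕ) :
    IsProbabilityMeasure (historyLaw alg B t) := by
  induction t with
  | zero => unfold historyLaw; infer_instance
  | succ t ih =>
    unfold historyLaw
    exact Measure.isProbabilityMeasure_map (measurable_extend B.θ t).aemeasurable

/-- The optimal action `a⋆ = θ / ‖θ‖` (for `θ ≠ 0`). -/
def Instance.optAction {n : ℕ} (B : Instance n) : EuclideanSpace ℝ (Fin n) :=
  ‖B.θ‖⁻¹ • B.θ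

/-- The instantaneous regret `r(a, a') = ⟪θ, a⟫ - ⟪θ, a'⟫` of `a'` with respect to `a`. -/
def Instance.instRegret {n : ℕ} (B : Instance n) (a a' : EuclideanSpace ℝ (Fin n)) : ℝ :=
  ⟪B.θ, a⟫ - ⟪B.θ, a'⟫

/-- The (pseudo-)regret `Reg(T) = ∑ t, r(a⋆, a_t)` along a history of `T` rounds. -/
def Instance.regret {n T : ℕ} (B : Instance n) (ω : History n T) : ℝ :=
  ∑ t : Fin T, B.instRegret B.optAction ((ω t).1 : EuclideanSpace ℝ (Fin n))

/-- The expected regret after `T` rounds of the algorithm `alg` on the instance `B`. -/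
def expectedRegret {n : ℕ} (alg : Algorithm n) (B : Instance n) (T : ℕ) : ℝ :=
  ∫ ω, B.regret ω ∂(historyLaw alg B T)

/-- The expected regret is the integral of an integrable (bounded, measurable) function. -/
lemma integrable_regret {n : ℕ} (alg : Algorithm n) (B : Instance n) (T : ℕ) :
    Integrable (fun ω : History n T => B.regret ω) (historyLaw alg B T) := by
  unfold Instance.regret Instance.instRegret
  refine integrable_finsetSum _ fun t _ => (integrable_const _).sub ?_
  refine Integrable.of_bound (C := ‖B.θ‖) ?_ (Filter.Eventually.of_forall fun ω => ?_)
  · exact Measurable.aestronglyMeasurable (by fun_prop)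
  · have h1 : ‖((ω t).1 : EuclideanSpace ℝ (Fin n))‖ ≤ 1 :=
      mem_closedBall_zero_iff.mp (ω t).1.2
    calc ‖⟪B.θ, ((ω t).1 : EuclideanSpace ℝ (Fin n))⟫‖
        ≤ ‖B.θ‖ * ‖((ω t).1 : EuclideanSpace ℝ (Fin n))‖ := norm_inner_le_norm _ _
      _ ≤ ‖B.θ‖ * 1 := by gcongr
      _ = ‖B.θ‖ := mul_one _

end LinBandit

end

noncomputable section

namespace LinBandit

/-! The hard parameters are half the hint plus `± ε` in each of the `d` orthogonal directions, with
independent choices of sign. Since actions lie in the unit ball, energy `V` spent in a direction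
costs regret at least `V / 4` along the hint, and all that can be gained in return is `ε` times the
correlation of the actions with the unknown sign (`norm_half_add_sum_excessRegret_le`).

This gain never pays on average. Flipping one sign changes the law of the history by a squared
Hellinger distance at most proportional to `ε ^ 2` times the energy spent in that direction
(`one_le_integral_likMean_add`). As `ε ^ 4 * T` is small, the correlation gained over the two signs
is at most a quarter of the total energy (`energy_sub_correlation_nonneg`). Averaging over all signs
leaves one `σ` with regret at least `T * (‖θ‖ - 1 / 2)`, which is of order `T * d * ε ^ 2`, that is
`d * √T`. -/

/-! ### Gaussian noise and exponential tilting. -/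

lemma lintegral_add_gaussianReal (u : ℝ) {f : ℝ → ENNReal} (hf : Measurable f) :
    ∫⁻ x, f (u + x) ∂(gaussianReal 0 1)
      = ∫⁻ x, ENNReal.ofReal (Real.exp (u * x - u ^ 2 / 2)) * f x ∂(gaussianReal 0 1) := by
  rw [← lintegral_map hf (measurable_const_add u), gaussianReal_map_const_add, zero_add,
    gaussianReal_of_var_ne_zero _ one_ne_zero, gaussianReal_of_var_ne_zero _ one_ne_zero,
    lintegral_withDensity_eq_lintegral_mul _ (measurable_gaussianPDF _ _) hf,
    lintegral_withDensity_eq_lintegral_mul _ (measurable_gaussianPDF _ _) (by fun_prop)]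
  refine lintegral_congr fun x => ?_
  simp only [Pi.mul_apply, gaussianPDF, ← mul_assoc]
  rw [← ENNReal.ofReal_mul (gaussianPDFReal_nonneg _ _ _)]
  congr 2
  simp only [gaussianPDFReal, NNReal.coe_one, mul_one, sub_zero]
  rw [mul_assoc, ← Real.exp_add]
  congr 2
  ring

lemma hasSubgaussianMGF_gaussianReal :
    HasSubgaussianMGF (fun x : ℝ => x) 1 (gaussianReal 0 1) where
  integrable_exp_mul := integrable_exp_mul_gaussianReal
  mgf_le t := by simp [mgf_fun_id_gaussianReal]

lemma integral_exp_mul_gaussianReal (u : ℝ) :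
    ∫ x, Real.exp (u * x) ∂(gaussianReal 0 1) = Real.exp (u ^ 2 / 2) := by
  have := congrFun (mgf_fun_id_gaussianReal (μ := 0) (v := 1)) u
  simpa [mgf] using this

/-- The instance with parameter `θ` and standard Gaussian noise in every round. -/
def gaussianInstance {n : ℕ} (θ : EuclideanSpace ℝ (Fin n)) : Instance n where
  θ := θ
  noise _ := gaussianReal 0 1
  noise_prob _ := inferInstance
  noise_subGaussian _ := hasSubgaussianMGF_gaussianReal

/-! ### Likelihood ratios and energy of a history. -/

variable {n : ℕ}

/-- The logarithm of the likelihood ratio of the parameters `θ` and `0` under Gaussian noise. -/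
def logLik (θ : EuclideanSpace ℝ (Fin n)) {t : ℕ} (ω : History n t) : ℝ :=
  ∑ s, (⟪((ω s).1 : EuclideanSpace ℝ (Fin n)), θ⟫ * (ω s).2
    - ⟪((ω s).1 : EuclideanSpace ℝ (Fin n)), θ⟫ ^ 2 / 2)

/-- The likelihood ratio of the parameters `θ` and `0` under Gaussian noise. -/
def lik (θ : EuclideanSpace ℝ (Fin n)) {t : ℕ} (ω : History n t) : ℝ :=
  Real.exp (logLik θ ω)

/-- The squared lengths of the actions of a history in the direction `v`, summed. -/
def energy (v : EuclideanSpace ℝ (Fin n)) {t : ℕ} (ω : History n t) : ℝ :=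
  ∑ s, ⟪((ω s).1 : EuclideanSpace ℝ (Fin n)), v⟫ ^ 2

@[fun_prop]
lemma measurable_logLik (θ : EuclideanSpace ℝ (Fin n)) (t : ℕ) :
    Measurable (logLik θ : History n t → ℝ) := by
  unfold logLik; fun_prop

@[fun_prop]
lemma measurable_lik (θ : EuclideanSpace ℝ (Fin n)) (t : ℕ) :
    Measurable (lik θ : History n t → ℝ) := by
  unfold lik; fun_prop

@[fun_prop]
lemma measurable_energy (θ : EuclideanSpace ℝ (Fin n)) (t : ℕ) :
    Measurable (energy θ : History n t → ℝ) := by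
  unfold energy; fun_prop

lemma lik_nonneg (θ : EuclideanSpace ℝ (Fin n)) {t : ℕ} (ω : History n t) : 0 ≤ lik θ ω :=
  (Real.exp_pos _).le

lemma energy_nonneg (v : EuclideanSpace ℝ (Fin n)) {t : ℕ} (ω : History n t) : 0 ≤ energy v ω :=
  Finset.sum_nonneg fun _ _ => sq_nonneg _

lemma abs_inner_le (a : Action n) (v : EuclideanSpace ℝ (Fin n)) :
    |⟪(a : EuclideanSpace ℝ (Fin n)), v⟫| ≤ ‖v‖ := by
  have h1 : ‖(a : EuclideanSpace ℝ (Fin n))‖ ≤ 1 := mem_closedBall_zero_iff.mp a.2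
  calc _ ≤ ‖(a : EuclideanSpace ℝ (Fin n))‖ * ‖v‖ := abs_real_inner_le_norm _ _
    _ ≤ 1 * ‖v‖ := by gcongr
    _ = ‖v‖ := one_mul _

lemma energy_le (v : EuclideanSpace ℝ (Fin n)) {t : ℕ} (ω : History n t) :
    energy v ω ≤ t * ‖v‖ ^ 2 := by
  calc energy v ω ≤ ∑ _s : Fin t, ‖v‖ ^ 2 := Finset.sum_le_sum fun s _ =>
        (sq_le_sq' (by linarith [(abs_le.mp (abs_inner_le (ω s).1 v)).1])
          (abs_le.mp (abs_inner_le (ω s).1 v)).2)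
    _ = t * ‖v‖ ^ 2 := by simp

lemma logLik_snoc (θ : EuclideanSpace ℝ (Fin n)) {t : ℕ} (ω : History n t) (a : Action n) (y : ℝ) :
    logLik θ (Fin.snoc (α := fun _ => Action n × ℝ) ω (a, y) : History n (t + 1))
      = logLik θ ω + (⟪(a : EuclideanSpace ℝ (Fin n)), θ⟫ * y
        - ⟪(a : EuclideanSpace ℝ (Fin n)), θ⟫ ^ 2 / 2) := by
  simp only [logLik, Fin.sum_univ_castSucc, Fin.snoc_castSucc, Fin.snoc_last]

lemma lik_snoc (θ : EuclideanSpace ℝ (Fin n)) {t : ℕ} (ω : History n t) (a : Action n) (y : ℝ) :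
    lik θ (Fin.snoc (α := fun _ => Action n × ℝ) ω (a, y) : History n (t + 1))
      = lik θ ω * Real.exp (⟪(a : EuclideanSpace ℝ (Fin n)), θ⟫ * y
        - ⟪(a : EuclideanSpace ℝ (Fin n)), θ⟫ ^ 2 / 2) := by
  rw [lik, logLik_snoc, Real.exp_add, lik]

lemma energy_snoc (v : EuclideanSpace ℝ (Fin n)) {t : ℕ} (ω : History n t) (a : Action n) (y : ℝ) :
    energy v (Fin.snoc (α := fun _ => Action n × ℝ) ω (a, y) : History n (t + 1))
      = energy v ω + ⟪(a : EuclideanSpace ℝ (Fin n)), v⟫ ^ 2 := by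
  simp [energy, Fin.sum_univ_castSucc]

lemma measurable_snoc (t : ℕ) :
    Measurable fun p : History n t × (Action n × ℝ) =>
      (Fin.snoc (α := fun _ => Action n × ℝ) p.1 p.2 : History n (t + 1)) := by
  refine measurable_pi_lambda _ fun i => ?_
  refine Fin.lastCases ?_ (fun j => ?_) i
  · simp only [Fin.snoc_last]; fun_prop
  · simp only [Fin.snoc_castSucc]; fun_prop

/-! ### Change of measure to the parameter `0`. -/

lemma lintegral_historyLaw_succ (alg : Algorithm n) (θ : EuclideanSpace ℝ (Fin n)) (t : ℕ)
    {f : History n (t + 1) → ENNReal} (hf : Measurable f) :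
    ∫⁻ ω, f ω ∂(historyLaw alg (gaussianInstance θ) (t + 1))
      = ∫⁻ ω, ∫⁻ a, ∫⁻ x, f (Fin.snoc (α := fun _ => Action n × ℝ) ω
          (a, ⟪(a : EuclideanSpace ℝ (Fin n)), θ⟫ + x)) ∂(gaussianReal 0 1) ∂(alg.policy t ω)
          ∂(historyLaw alg (gaussianInstance θ) t) := by
  have hm := measurable_extend θ t
  have hfm : Measurable fun p => f (extend θ t p) := hf.comp hm
  rw [historyLaw]
  change ∫⁻ ω, f ω ∂(((historyLaw alg (gaussianInstance θ) t ⊗ₘ alg.policy t).prod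
    (gaussianReal 0 1)).map (extend θ t)) = _
  rw [lintegral_map hf hm, lintegral_prod _ hfm.aemeasurable,
    Measure.lintegral_compProd]
  · rfl
  · exact hfm.lintegral_prod_right'

/-- Change of measure: the law of the history under the parameter `θ` has density `lik θ` with
respect to its law under the parameter `0`. -/
lemma lintegral_historyLaw_eq (alg : Algorithm n) (θ : EuclideanSpace ℝ (Fin n)) (t : ℕ)
    {f : History n t → ENNReal} (hf : Measurable f) :
    ∫⁻ ω, f ω ∂(historyLaw alg (gaussianInstance θ) t)
      = ∫⁻ ω, ENNReal.ofReal (lik θ ω) * f ω ∂(historyLaw alg (gaussianInstance 0) t) := by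
  induction t with
  | zero => simp [historyLaw, lik, logLik]
  | succ t ih =>
    have hs := measurable_snoc (n := n) t
    rw [lintegral_historyLaw_succ _ _ _ hf, lintegral_historyLaw_succ _ _ _ (by fun_prop), ih]
    · refine lintegral_congr fun ω => ?_
      rw [← lintegral_const_mul]
      · refine lintegral_congr fun a => ?_
        have hfa : Measurable fun y : ℝ =>
            f (Fin.snoc (α := fun _ => Action n × ℝ) ω (a, y)) := by
          exact hf.comp (hs.comp (by fun_prop : Measurable fun y : ℝ => (ω, (a, y))))
        rw [lintegral_add_gaussianReal _ hfa, ← lintegral_const_mul _ (by fun_prop)]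
        refine lintegral_congr fun x => ?_
        -- Under the parameter `0` the reward is the noise itself, so the Gaussian tilt is exactly
        -- the last factor of `lik`.
        rw [inner_zero_right, zero_add, lik_snoc, ENNReal.ofReal_mul (lik_nonneg _ _), mul_assoc]
      · refine Measurable.lintegral_prod_right' (ν := gaussianReal 0 1)
          (f := fun p : Action n × ℝ => f (Fin.snoc (α := fun _ => Action n × ℝ) ω
            (p.1, ⟪(p.1 : EuclideanSpace ℝ (Fin n)), θ⟫ + p.2))) ?_
        exact hf.comp (hs.comp (by fun_prop : Measurable fun p : Action n × ℝ =>
          (ω, (p.1, ⟪(p.1 : EuclideanSpace ℝ (Fin n)), θ⟫ + p.2))))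
    · refine Measurable.lintegral_kernel_prod_right (κ := alg.policy t)
        (f := fun ω a => ∫⁻ x, f (Fin.snoc (α := fun _ => Action n × ℝ) ω
          (a, ⟪(a : EuclideanSpace ℝ (Fin n)), θ⟫ + x)) ∂(gaussianReal 0 1)) ?_
      exact (hf.comp (measurable_extend θ t)).lintegral_prod_right'

lemma historyLaw_eq_withDensity (alg : Algorithm n) (θ : EuclideanSpace ℝ (Fin n)) (t : ℕ) :
    historyLaw alg (gaussianInstance θ) t
      = (historyLaw alg (gaussianInstance 0) t).withDensity fun ω => ENNReal.ofReal (lik θ ω) := by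
  refine Measure.ext_of_lintegral _ fun f hf => ?_
  rw [lintegral_historyLaw_eq _ _ _ hf,
    lintegral_withDensity_eq_lintegral_mul _ (by fun_prop) hf]
  rfl

/-- No regularity of `f` is needed: if one side is not integrable, neither is the other, and both
integrals are `0`. -/
lemma integral_historyLaw_eq (alg : Algorithm n) (θ : EuclideanSpace ℝ (Fin n)) (t : ℕ)
    (f : History n t → ℝ) :
    ∫ ω, f ω ∂(historyLaw alg (gaussianInstance θ) t)
      = ∫ ω, lik θ ω * f ω ∂(historyLaw alg (gaussianInstance 0) t) := by
  rw [historyLaw_eq_withDensity, integral_withDensity_eq_integral_toReal_smul (by fun_prop)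
    (by simp)]
  simp [ENNReal.toReal_ofReal (lik_nonneg _ _)]

lemma integrable_lik (alg : Algorithm n) (θ : EuclideanSpace ℝ (Fin n)) (t : ℕ) :
    Integrable (lik θ : History n t → ℝ) (historyLaw alg (gaussianInstance 0) t) := by
  refine ⟨by fun_prop, ?_⟩
  have h := lintegral_historyLaw_eq alg θ t (f := fun _ => 1) measurable_const
  simp only [lintegral_const, measure_univ, mul_one] at h
  rw [hasFiniteIntegral_iff_ofReal (Filter.Eventually.of_forall (lik_nonneg θ)), ← h]
  simp

lemma integral_lik (alg : Algorithm n) (θ : EuclideanSpace ℝ (Fin n)) (t : ℕ) :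
    ∫ ω, lik θ ω ∂(historyLaw alg (gaussianInstance 0) t) = 1 := by
  simpa using (integral_historyLaw_eq alg θ t fun _ => 1).symm

lemma integrable_lik_mul (alg : Algorithm n) (θ : EuclideanSpace ℝ (Fin n)) (t : ℕ)
    {f : History n t → ℝ} (hf : Measurable f) {C : ℝ} (hC : ∀ ω, |f ω| ≤ C) :
    Integrable (fun ω => lik θ ω * f ω) (historyLaw alg (gaussianInstance 0) t) :=
  (integrable_lik alg θ t).mul_bdd (by fun_prop) (Filter.Eventually.of_forall hC)

/-! ### Hellinger affinity of adaptively generated histories. -/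

/-- The geometric mean of the likelihood ratios of `θ` and `θ'`. -/
def likMean (θ θ' : EuclideanSpace ℝ (Fin n)) {t : ℕ} (ω : History n t) : ℝ :=
  Real.exp ((logLik θ ω + logLik θ' ω) / 2)

@[fun_prop]
lemma measurable_likMean (θ θ' : EuclideanSpace ℝ (Fin n)) (t : ℕ) :
    Measurable (likMean θ θ' : History n t → ℝ) := by
  unfold likMean; fun_prop

lemma likMean_nonneg (θ θ' : EuclideanSpace ℝ (Fin n)) {t : ℕ} (ω : History n t) :
    0 ≤ likMean θ θ' ω :=
  (Real.exp_pos _).le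

lemma lik_eq_exp_half_sq (θ : EuclideanSpace ℝ (Fin n)) {t : ℕ} (ω : History n t) :
    lik θ ω = Real.exp (logLik θ ω / 2) ^ 2 := by
  rw [lik, ← Real.exp_nat_mul]
  congr 1
  push_cast
  ring

lemma sq_sub_exp_half (θ θ' : EuclideanSpace ℝ (Fin n)) {t : ℕ} (ω : History n t) :
    (Real.exp (logLik θ ω / 2) - Real.exp (logLik θ' ω / 2)) ^ 2
      = lik θ ω + lik θ' ω - 2 * likMean θ θ' ω := by
  rw [lik_eq_exp_half_sq, lik_eq_exp_half_sq, likMean, add_div, Real.exp_add]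
  ring

lemma two_mul_likMean_le (θ θ' : EuclideanSpace ℝ (Fin n)) {t : ℕ} (ω : History n t) :
    2 * likMean θ θ' ω ≤ lik θ ω + lik θ' ω := by
  linarith [sq_sub_exp_half θ θ' ω, sq_nonneg
    (Real.exp (logLik θ ω / 2) - Real.exp (logLik θ' ω / 2))]

lemma likMean_snoc (θ θ' : EuclideanSpace ℝ (Fin n)) {t : ℕ} (ω : History n t) (a : Action n)
    (y : ℝ) :
    likMean θ θ' (Fin.snoc (α := fun _ => Action n × ℝ) ω (a, y) : History n (t + 1))
      = likMean θ θ' ω * Real.exp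
        ((⟪(a : EuclideanSpace ℝ (Fin n)), θ⟫ + ⟪(a : EuclideanSpace ℝ (Fin n)), θ'⟫) / 2 * y
        - (⟪(a : EuclideanSpace ℝ (Fin n)), θ⟫ ^ 2
          + ⟪(a : EuclideanSpace ℝ (Fin n)), θ'⟫ ^ 2) / 4) := by
  rw [likMean, logLik_snoc, logLik_snoc, likMean, ← Real.exp_add]
  congr 1
  ring

/-- The geometric mean of two likelihood ratios plus a multiple of the energy in the direction in
which the parameters differ; its integral bounds the Hellinger affinity from below. -/
def affinityPotential (θ θ' : EuclideanSpace ℝ (Fin n)) {t : ℕ}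
    (ω : History n t) : ℝ :=
  likMean θ θ' ω + 1 / 16 * ((lik θ ω + lik θ' ω) * energy (θ - θ') ω)

@[fun_prop]
lemma measurable_affinityPotential (θ θ' : EuclideanSpace ℝ (Fin n)) (t : ℕ) :
    Measurable (affinityPotential θ θ' : History n t → ℝ) := by
  unfold affinityPotential; fun_prop

lemma affinityPotential_nonneg (θ θ' : EuclideanSpace ℝ (Fin n)) {t : ℕ} (ω : History n t) :
    0 ≤ affinityPotential θ θ' ω := by
  have := likMean_nonneg θ θ' ω
  have := lik_nonneg θ ω
  have := lik_nonneg θ' ω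
  have := energy_nonneg (θ - θ') ω
  unfold affinityPotential
  positivity

lemma integral_exp_mul_sub_gaussianReal (u c : ℝ) :
    Integrable (fun y => Real.exp (u * y - c)) (gaussianReal 0 1) ∧
      ∫ y, Real.exp (u * y - c) ∂(gaussianReal 0 1) = Real.exp (u ^ 2 / 2 - c) := by
  have h : (fun y => Real.exp (u * y - c)) = fun y => Real.exp (u * y) * Real.exp (-c) := by
    funext y; rw [← Real.exp_add, sub_eq_add_neg]
  refine ⟨h ▸ (integrable_exp_mul_gaussianReal u).mul_const _, ?_⟩
  rw [h, integral_mul_const, integral_exp_mul_gaussianReal, ← Real.exp_add, sub_eq_add_neg]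

/-- Submartingale step under the parameter `0`: the affinity lost in one round is compensated by the
energy added in that round. -/
lemma affinityPotential_le_lintegral_snoc (θ θ' : EuclideanSpace ℝ (Fin n)) {t : ℕ}
    (ω : History n t) (a : Action n) :
    ENNReal.ofReal (affinityPotential θ θ' ω) ≤ ∫⁻ y, ENNReal.ofReal (affinityPotential θ θ'
      (Fin.snoc (α := fun _ => Action n × ℝ) ω (a, y) : History n (t + 1)))
      ∂(gaussianReal 0 1) := by
  set u := ⟪(a : EuclideanSpace ℝ (Fin n)), θ⟫ with hu
  set v := ⟪(a : EuclideanSpace ℝ (Fin n)), θ'⟫ with hv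
  set E := energy (θ - θ') ω + (u - v) ^ 2 with hE
  obtain ⟨i1, e1⟩ := integral_exp_mul_sub_gaussianReal ((u + v) / 2) ((u ^ 2 + v ^ 2) / 4)
  obtain ⟨i2, e2⟩ := integral_exp_mul_sub_gaussianReal u (u ^ 2 / 2)
  obtain ⟨i3, e3⟩ := integral_exp_mul_sub_gaussianReal v (v ^ 2 / 2)
  have key : ∀ y, affinityPotential θ θ'
      (Fin.snoc (α := fun _ => Action n × ℝ) ω (a, y) : History n (t + 1))
      = likMean θ θ' ω * Real.exp ((u + v) / 2 * y - (u ^ 2 + v ^ 2) / 4)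
        + (E / 16 * lik θ ω * Real.exp (u * y - u ^ 2 / 2)
          + E / 16 * lik θ' ω * Real.exp (v * y - v ^ 2 / 2)) := by
    intro y
    rw [affinityPotential, likMean_snoc, lik_snoc, lik_snoc, energy_snoc, inner_sub_right]
    ring
  have j1 := i1.const_mul (likMean θ θ' ω)
  have j2 := i2.const_mul (E / 16 * lik θ ω)
  have j3 := i3.const_mul (E / 16 * lik θ' ω)
  have hint : Integrable (fun y => affinityPotential θ θ'
      (Fin.snoc (α := fun _ => Action n × ℝ) ω (a, y) : History n (t + 1)))
      (gaussianReal 0 1) := by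
    simp only [key]; exact j1.fun_add (j2.fun_add j3)
  rw [← ofReal_integral_eq_lintegral_ofReal hint
    (Filter.Eventually.of_forall fun _ => affinityPotential_nonneg _ _ _)]
  refine ENNReal.ofReal_le_ofReal ?_
  simp only [key]
  rw [integral_add j1 (j2.fun_add j3), integral_add j2 j3, integral_const_mul, integral_const_mul,
    integral_const_mul, e1, e2, e3, sub_self, sub_self, Real.exp_zero]
  -- The exponent equals `-(u - v) ^ 2 / 8`.
  have hexp : 1 - (u - v) ^ 2 / 8 ≤ Real.exp (((u + v) / 2) ^ 2 / 2 - (u ^ 2 + v ^ 2) / 4) := by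
    refine le_trans (le_of_eq ?_) (Real.add_one_le_exp _)
    ring
  have h1 := mul_le_mul_of_nonneg_left hexp (likMean_nonneg θ θ' ω)
  -- Bounding `likMean` by the arithmetic mean turns the loss factor `1 / 8` into the weight `1 /
  -- 16` of the potential.
  have h2 := mul_le_mul_of_nonneg_right (two_mul_likMean_le θ θ' ω) (sq_nonneg (u - v))
  rw [affinityPotential, hE]
  linarith

/-- The potential of the empty history is `1`, and its mean does not decrease, whatever the policy.
-/
lemma one_le_lintegral_affinityPotential (alg : Algorithm n) (θ θ' : EuclideanSpace ℝ (Fin n))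
    (t : ℕ) :
    1 ≤ ∫⁻ ω : History n t, ENNReal.ofReal (affinityPotential θ θ' ω)
      ∂(historyLaw alg (gaussianInstance 0) t) := by
  induction t with
  | zero => simp [historyLaw, affinityPotential, likMean, logLik, energy]
  | succ t ih =>
    rw [lintegral_historyLaw_succ _ _ _ (by fun_prop)]
    refine ih.trans (lintegral_mono fun ω => ?_)
    calc ENNReal.ofReal (affinityPotential θ θ' ω)
        = ∫⁻ _a, ENNReal.ofReal (affinityPotential θ θ' ω) ∂(alg.policy t ω) := by simp
      _ ≤ _ := lintegral_mono fun a => by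
          simpa only [inner_zero_right, zero_add] using
            affinityPotential_le_lintegral_snoc θ θ' ω a

lemma abs_energy_le (v : EuclideanSpace ℝ (Fin n)) {t : ℕ} (ω : History n t) :
    |energy v ω| ≤ t * ‖v‖ ^ 2 := by
  rw [abs_of_nonneg (energy_nonneg v ω)]
  exact energy_le v ω

lemma integrable_likMean (alg : Algorithm n) (θ θ' : EuclideanSpace ℝ (Fin n)) (t : ℕ) :
    Integrable (likMean θ θ' : History n t → ℝ) (historyLaw alg (gaussianInstance 0) t) := by
  refine ((integrable_lik alg θ t).fun_add (integrable_lik alg θ' t)).mono' (by fun_prop)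
    (Filter.Eventually.of_forall fun ω => ?_)
  rw [Real.norm_of_nonneg (likMean_nonneg _ _ _)]
  change _ ≤ lik θ ω + lik θ' ω
  linarith [two_mul_likMean_le θ θ' ω, likMean_nonneg θ θ' ω]

/-- The Hellinger affinity of the laws of the history under two parameters is close to `1` when the
actions have little energy in the direction in which the parameters differ. -/
lemma one_le_integral_likMean_add (alg : Algorithm n) (θ θ' : EuclideanSpace ℝ (Fin n)) (t : ℕ) :
    1 ≤ ∫ ω : History n t, likMean θ θ' ω ∂(historyLaw alg (gaussianInstance 0) t)
      + 1 / 16 * (∫ ω : History n t, lik θ ω * energy (θ - θ') ω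
          ∂(historyLaw alg (gaussianInstance 0) t)
        + ∫ ω : History n t, lik θ' ω * energy (θ - θ') ω
          ∂(historyLaw alg (gaussianInstance 0) t)) := by
  have i1 := integrable_likMean alg θ θ' t
  have i2 := integrable_lik_mul alg θ t (measurable_energy (θ - θ') t) (abs_energy_le _)
  have i3 := integrable_lik_mul alg θ' t (measurable_energy (θ - θ') t) (abs_energy_le _)
  have i23 := (i2.fun_add i3).const_mul (1 / 16)
  have h := one_le_lintegral_affinityPotential alg θ θ' t
  have he : (affinityPotential θ θ' : History n t → ℝ) = fun ω => likMean θ θ' ω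
      + 1 / 16 * (lik θ ω * energy (θ - θ') ω + lik θ' ω * energy (θ - θ') ω) := by
    funext ω; rw [affinityPotential]; ring
  have hi : Integrable (affinityPotential θ θ' : History n t → ℝ)
      (historyLaw alg (gaussianInstance 0) t) := by
    rw [he]; exact i1.fun_add i23
  rw [← ofReal_integral_eq_lintegral_ofReal hi
    (Filter.Eventually.of_forall fun _ => affinityPotential_nonneg _ _ _),
    ENNReal.one_le_ofReal, he] at h
  rwa [integral_add i1 i23, integral_const_mul, integral_add i2 i3] at h

/-! ### Two-point argument in one direction. -/

/-- If two parameters differ by `2 ε • e`, then no algorithm can correlate its actions with the sign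
of this difference without paying for it in energy. -/
lemma energy_sub_correlation_nonneg (alg : Algorithm n) (θ θ' e : EuclideanSpace ℝ (Fin n))
    (T : ℕ) (ε : ℝ) (hε : ε ^ 4 * T ≤ 1 / 16) (he : θ - θ' = (2 * ε) • e) :
    0 ≤ ∫ ω : History n T, (energy e ω / 4
          - ε * ∑ s, ⟪((ω s).1 : EuclideanSpace ℝ (Fin n)), e⟫)
          ∂(historyLaw alg (gaussianInstance θ) T)
      + ∫ ω : History n T, (energy e ω / 4
          + ε * ∑ s, ⟪((ω s).1 : EuclideanSpace ℝ (Fin n)), e⟫)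
          ∂(historyLaw alg (gaussianInstance θ') T) := by
  set μ := historyLaw alg (gaussianInstance 0) T
  set A : History n T → ℝ := fun ω => ∑ s, ⟪((ω s).1 : EuclideanSpace ℝ (Fin n)), e⟫ with hA
  have hAm : Measurable A := by fun_prop
  have hAb : ∀ ω, |A ω| ≤ T * ‖e‖ := fun ω => by
    calc |A ω| ≤ ∑ s, |⟪((ω s).1 : EuclideanSpace ℝ (Fin n)), e⟫| := Finset.abs_sum_le_sum_abs _ _
      _ ≤ ∑ _s : Fin T, ‖e‖ := Finset.sum_le_sum fun s _ => abs_inner_le _ _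
      _ = T * ‖e‖ := by simp
  have hee : ∀ ω : History n T, energy (θ - θ') ω = 4 * ε ^ 2 * energy e ω := fun ω => by
    simp only [energy, he, inner_smul_right, Finset.mul_sum]
    exact Finset.sum_congr rfl fun _ _ => by ring
  have H := one_le_integral_likMean_add alg θ θ' T
  have im := integrable_likMean alg θ θ' T
  have l1 := integrable_lik alg θ T
  have l2 := integrable_lik alg θ' T
  have i1 := integrable_lik_mul alg θ T (measurable_energy e T) (abs_energy_le _)
  have i2 := integrable_lik_mul alg θ' T (measurable_energy e T) (abs_energy_le _)
  have a1 := integrable_lik_mul alg θ T hAm hAb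
  have a2 := integrable_lik_mul alg θ' T hAm hAb
  simp only [hee, mul_left_comm _ (4 * ε ^ 2)] at H
  rw [integral_const_mul, integral_const_mul] at H
  have hpt : ∀ ω, ε * (lik θ ω * A ω - lik θ' ω * A ω)
      ≤ 1 / 8 * (lik θ ω * energy e ω + lik θ' ω * energy e ω)
        + 4 * ε ^ 2 * T * (lik θ ω + lik θ' ω - 2 * likMean θ θ' ω) := by
    intro ω
    rw [← sq_sub_exp_half, lik_eq_exp_half_sq θ, lik_eq_exp_half_sq θ']
    set p := Real.exp (logLik θ ω / 2)
    set q := Real.exp (logLik θ' ω / 2)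
    -- With `T` written as a sum, the bound is proved round by round: AM-GM for `x * (p + q) / 4`
    -- and `2 * ε * (p - q)`, together with `(p + q) ^ 2 ≤ 2 * (p ^ 2 + q ^ 2)`.
    have hT : (T : ℝ) = ∑ _s : Fin T, (1 : ℝ) := by simp
    rw [hT, hA, energy]
    simp only [Finset.mul_sum, Finset.sum_mul, ← Finset.sum_add_distrib,
      ← Finset.sum_sub_distrib]
    refine Finset.sum_le_sum fun s _ => ?_
    set x := ⟪((ω s).1 : EuclideanSpace ℝ (Fin n)), e⟫
    nlinarith [sq_nonneg (x * (p + q) / 4 - 2 * ε * (p - q)), sq_nonneg (x * (p - q))]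
  have hI := integral_mono ((a1.sub a2).const_mul ε)
    (((i1.fun_add i2).const_mul (1 / 8)).add (((l1.fun_add l2).sub (im.const_mul 2)).const_mul
      (4 * ε ^ 2 * T))) hpt
  have ei : ∫ ω, (1 / 8 * (lik θ ω * energy e ω + lik θ' ω * energy e ω)
        + 4 * ε ^ 2 * T * (lik θ ω + lik θ' ω - 2 * likMean θ θ' ω)) ∂μ
      = 1 / 8 * (∫ ω, lik θ ω * energy e ω ∂μ + ∫ ω, lik θ' ω * energy e ω ∂μ)
        + 4 * ε ^ 2 * T * (2 - 2 * ∫ ω, likMean θ θ' ω ∂μ) := by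
    have k1 := (i1.fun_add i2).const_mul (1 / 8)
    have k2 : Integrable (fun ω => 4 * ε ^ 2 * T * (lik θ ω + lik θ' ω - 2 * likMean θ θ' ω)) μ :=
      ((l1.fun_add l2).sub (im.const_mul 2)).const_mul (4 * ε ^ 2 * T)
    rw [integral_add k1 k2, integral_const_mul, integral_const_mul, integral_add i1 i2,
      integral_sub (l1.fun_add l2) (im.const_mul 2), integral_const_mul, integral_add l1 l2,
      integral_lik, integral_lik, one_add_one_eq_two]
  have el : ∫ ω, ε * (lik θ ω * A ω - lik θ' ω * A ω) ∂μ
      = ε * (∫ ω, lik θ ω * A ω ∂μ - ∫ ω, lik θ' ω * A ω ∂μ) := by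
    rw [integral_const_mul, integral_sub a1 a2]
  have e1 : ∫ ω, (energy e ω / 4 - ε * A ω) ∂(historyLaw alg (gaussianInstance θ) T)
      = 1 / 4 * ∫ ω, lik θ ω * energy e ω ∂μ - ε * ∫ ω, lik θ ω * A ω ∂μ := by
    rw [integral_historyLaw_eq, ← integral_const_mul, ← integral_const_mul,
      ← integral_sub (i1.const_mul _) (a1.const_mul _)]
    exact integral_congr_ae (Filter.Eventually.of_forall fun ω => by ring)
  have e2 : ∫ ω, (energy e ω / 4 + ε * A ω) ∂(historyLaw alg (gaussianInstance θ') T)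
      = 1 / 4 * ∫ ω, lik θ' ω * energy e ω ∂μ + ε * ∫ ω, lik θ' ω * A ω ∂μ := by
    rw [integral_historyLaw_eq, ← integral_const_mul, ← integral_const_mul,
      ← integral_add (i2.const_mul _) (a2.const_mul _)]
    exact integral_congr_ae (Filter.Eventually.of_forall fun ω => by ring)
  rw [e1, e2]
  have hI' : ε * (∫ ω, lik θ ω * A ω ∂μ - ∫ ω, lik θ' ω * A ω ∂μ)
      ≤ 1 / 8 * (∫ ω, lik θ ω * energy e ω ∂μ + ∫ ω, lik θ' ω * energy e ω ∂μ)
        + 4 * ε ^ 2 * T * (2 - 2 * ∫ ω, likMean θ θ' ω ∂μ) := by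
    rw [← el, ← ei]; exact hI
  set V := ∫ ω, lik θ ω * energy e ω ∂μ
  set V' := ∫ ω, lik θ' ω * energy e ω ∂μ
  have hV : 0 ≤ V := integral_nonneg fun ω => mul_nonneg (lik_nonneg _ _) (energy_nonneg _ _)
  have hV' : 0 ≤ V' := integral_nonneg fun ω => mul_nonneg (lik_nonneg _ _) (energy_nonneg _ _)
  have hH : 2 - 2 * ∫ ω, likMean θ θ' ω ∂μ ≤ ε ^ 2 / 2 * (V + V') := by linarith
  -- The Hellinger term costs `2 * ε ^ 4 * T ≤ 1 / 8` of `V + V'`; with the `1 / 8` from AM-GM this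
  -- exhausts the available `1 / 4`.
  have h3 := mul_le_mul_of_nonneg_left hH (by positivity : 0 ≤ 4 * ε ^ 2 * (T : ℝ))
  have h4 := mul_le_mul_of_nonneg_right hε (add_nonneg hV hV')
  nlinarith

/-! ### Hard instances and averaging over signs. -/

section HardInstances

variable {d : ℕ} (b : OrthonormalBasis (Fin (d + 1)) ℝ (EuclideanSpace ℝ (Fin (d + 1))))
  (ε : ℝ) (σ : Fin d → ℤˣ)

/-- Half the first basis vector, perturbed by `± ε` in all other directions. -/
def signParam : EuclideanSpace ℝ (Fin (d + 1)) :=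
  (1 / 2 : ℝ) • b 0 + ∑ i, (ε * ((σ i : ℤ) : ℝ)) • b i.succ

lemma sign_sq (u : ℤˣ) : ((u : ℤ) : ℝ) ^ 2 = 1 := by
  rcases Int.units_eq_one_or u with h | h <;> simp [h]

lemma inner_signParam (a : EuclideanSpace ℝ (Fin (d + 1))) :
    ⟪a, signParam b ε σ⟫ = 1 / 2 * ⟪a, b 0⟫ + ∑ i, ε * ((σ i : ℤ) : ℝ) * ⟪a, b i.succ⟫ := by
  simp [signParam, inner_add_right, inner_sum, inner_smul_right]

lemma inner_basis_zero_signParam : ⟪b 0, signParam b ε σ⟫ = 1 / 2 := by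
  simp [inner_signParam, b.inner_eq_ite, (Fin.succ_ne_zero _).symm]

lemma inner_basis_succ_signParam (i : Fin d) :
    ⟪b i.succ, signParam b ε σ⟫ = ε * ((σ i : ℤ) : ℝ) := by
  simp [inner_signParam, b.inner_eq_ite, Fin.succ_ne_zero]

lemma norm_sq_eq_sum_succ (x : EuclideanSpace ℝ (Fin (d + 1))) :
    ‖x‖ ^ 2 = ⟪b 0, x⟫ ^ 2 + ∑ i : Fin d, ⟪b i.succ, x⟫ ^ 2 := by
  rw [← b.sum_sq_norm_inner_right x, Fin.sum_univ_succ]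
  simp

lemma norm_sq_signParam : ‖signParam b ε σ‖ ^ 2 = 1 / 4 + d * ε ^ 2 := by
  rw [norm_sq_eq_sum_succ b, inner_basis_zero_signParam]
  simp only [inner_basis_succ_signParam, mul_pow, sign_sq]
  norm_num

lemma norm_sq_signParam_sub : ‖signParam b ε σ - (1 / 2 : ℝ) • b 0‖ ^ 2 = d * ε ^ 2 := by
  rw [norm_sub_sq_real, norm_sq_signParam, inner_smul_right, real_inner_comm,
    inner_basis_zero_signParam, norm_smul, b.norm_eq_one]
  norm_num
  ring

lemma half_le_norm_signParam : 1 / 2 ≤ ‖signParam b ε σ‖ := by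
  refine (pow_le_pow_iff_left₀ (by norm_num) (norm_nonneg _) two_ne_zero).mp ?_
  rw [norm_sq_signParam]
  nlinarith [mul_nonneg (Nat.cast_nonneg (α := ℝ) d) (sq_nonneg ε)]

lemma inner_optAction {n : ℕ} (B : Instance n) (hB : B.θ ≠ 0) : ⟪B.θ, B.optAction⟫ = ‖B.θ‖ := by
  have := norm_ne_zero_iff.mpr hB
  rw [Instance.optAction, inner_smul_right, real_inner_self_eq_norm_sq]
  field_simp

lemma signParam_sub_flip (i : Fin d) :
    signParam b ε σ - signParam b ε (σ * Pi.mulSingle i (-1))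
      = (2 * (ε * ((σ i : ℤ) : ℝ))) • b i.succ := by
  rw [signParam, signParam, add_sub_add_left_eq_sub, ← Finset.sum_sub_distrib,
    Finset.sum_eq_single i]
  · rw [← sub_smul]
    congr 1
    simp
    ring
  · intro j _ hj
    simp [Pi.mulSingle_eq_of_ne hj]
  · simp

/-- The part of the regret on `signParam b ε σ` that is incurred in the direction `b i.succ`, up to
the constant that the action `b 0` would incur. -/
def excessRegret {T : ℕ} (i : Fin d) (ω : History (d + 1) T) : ℝ :=
  energy (b i.succ) ω / 4
    - ε * ((σ i : ℤ) : ℝ) * ∑ s, ⟪((ω s).1 : EuclideanSpace ℝ (Fin (d + 1))), b i.succ⟫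

lemma norm_half_add_sum_excessRegret_le {T : ℕ} (ω : History (d + 1) T) :
    T * (‖signParam b ε σ‖ - 1 / 2) + ∑ i, excessRegret b ε σ i ω
      ≤ (gaussianInstance (signParam b ε σ)).regret ω := by
  have h0 : (gaussianInstance (signParam b ε σ)).θ ≠ 0 := by
    refine norm_ne_zero_iff.mp (ne_of_gt ?_)
    exact lt_of_lt_of_le (by norm_num) (half_le_norm_signParam b ε σ)
  have hT : (T : ℝ) * (‖signParam b ε σ‖ - 1 / 2) = ∑ _s : Fin T, (‖signParam b ε σ‖ - 1 / 2) := by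
    rw [Finset.sum_const, Finset.card_univ, Fintype.card_fin, nsmul_eq_mul]
  simp only [Instance.regret, Instance.instRegret, inner_optAction _ h0, excessRegret, energy,
    Finset.sum_div, Finset.mul_sum, ← Finset.sum_sub_distrib]
  rw [hT, Finset.sum_comm, ← Finset.sum_add_distrib]
  refine Finset.sum_le_sum fun s _ => ?_
  have ha : ‖((ω s).1 : EuclideanSpace ℝ (Fin (d + 1)))‖ ≤ 1 :=
    mem_closedBall_zero_iff.mp (ω s).1.2
  set a := ((ω s).1 : EuclideanSpace ℝ (Fin (d + 1)))
  change _ ≤ ‖signParam b ε σ‖ - ⟪signParam b ε σ, a⟫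
  rw [real_inner_comm, inner_signParam, Finset.sum_sub_distrib, ← Finset.sum_div]
  have hn := norm_sq_eq_sum_succ b a
  simp only [real_inner_comm a] at hn
  -- With `x = ⟪a, b 0⟫`, the other squared coordinates sum to at most `1 - x ^ 2`, and `(1 - x) / 2
  -- - (1 - x ^ 2) / 4 = (1 - x) ^ 2 / 4`.
  nlinarith [sq_nonneg (⟪a, b 0⟫ - 1), norm_nonneg a]

lemma integrable_excessRegret (alg : Algorithm (d + 1)) (B : Instance (d + 1)) (T : ℕ)
    (i : Fin d) :
    Integrable (excessRegret b ε σ i : History (d + 1) T → ℝ) (historyLaw alg B T) := by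
  unfold excessRegret
  refine Integrable.sub (Integrable.div_const (Integrable.of_bound
    (Measurable.aestronglyMeasurable (by fun_prop)) (T * ‖b i.succ‖ ^ 2)
    (Filter.Eventually.of_forall (abs_energy_le (b i.succ)))) 4) (Integrable.const_mul
    (integrable_finsetSum _ fun s _ => Integrable.of_bound (C := ‖b i.succ‖)
      (Measurable.aestronglyMeasurable (by fun_prop))
      (Filter.Eventually.of_forall fun ω => abs_inner_le (ω s).1 _)) _)

lemma le_expectedRegret_signParam (alg : Algorithm (d + 1)) (T : ℕ) :
    T * (‖signParam b ε σ‖ - 1 / 2) + ∑ i, ∫ ω : History (d + 1) T, excessRegret b ε σ i ω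
        ∂(historyLaw alg (gaussianInstance (signParam b ε σ)) T)
      ≤ expectedRegret alg (gaussianInstance (signParam b ε σ)) T := by
  have hi := integrable_excessRegret b ε σ alg (gaussianInstance (signParam b ε σ)) T
  have hs := integrable_finsetSum Finset.univ fun i _ => hi i
  have h := integral_mono ((integrable_const (T * (‖signParam b ε σ‖ - 1 / 2))).fun_add hs)
    (integrable_regret alg (gaussianInstance (signParam b ε σ)) T)
    (norm_half_add_sum_excessRegret_le b ε σ)
  rw [integral_add (integrable_const _) hs, integral_finsetSum _ fun i _ => hi i] at h
  simpa [expectedRegret] using h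

/-- Flipping the `i`-th sign permutes the sign vectors; each flipped pair contributes a nonnegative
amount by `energy_sub_correlation_nonneg`, used with `ε * σ i` in place of `ε`. -/
lemma sum_integral_excessRegret_nonneg (alg : Algorithm (d + 1)) (T : ℕ)
    (hε : ε ^ 4 * T ≤ 1 / 16) (i : Fin d) :
    0 ≤ ∑ σ, ∫ ω : History (d + 1) T, excessRegret b ε σ i ω
        ∂(historyLaw alg (gaussianInstance (signParam b ε σ)) T) := by
  set F : (Fin d → ℤˣ) → ℝ := fun σ => ∫ ω : History (d + 1) T, excessRegret b ε σ i ω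
        ∂(historyLaw alg (gaussianInstance (signParam b ε σ)) T) with hF
  have hflip : ∑ σ, F (σ * Pi.mulSingle i (-1)) = ∑ σ, F σ :=
    Equiv.sum_comp (Equiv.mulRight (Pi.mulSingle i (-1))) F
  have hpair : ∀ σ, 0 ≤ F σ + F (σ * Pi.mulSingle i (-1)) := by
    intro σ
    have hε' : (ε * ((σ i : ℤ) : ℝ)) ^ 4 * T ≤ 1 / 16 := by
      have : (ε * ((σ i : ℤ) : ℝ)) ^ 4 = ε ^ 4 * (((σ i : ℤ) : ℝ) ^ 2) ^ 2 := by ring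
      rwa [this, sign_sq, one_pow, mul_one]
    have h := energy_sub_correlation_nonneg alg _ _ _ T _ hε' (signParam_sub_flip b ε σ i)
    simpa [hF, excessRegret] using h
  have hsum : 0 ≤ ∑ σ, (F σ + F (σ * Pi.mulSingle i (-1))) := Finset.sum_nonneg fun σ _ => hpair σ
  rw [Finset.sum_add_distrib, hflip] at hsum
  linarith

lemma exists_signs_le_expectedRegret (alg : Algorithm (d + 1)) (T : ℕ)
    (hε : ε ^ 4 * T ≤ 1 / 16) :
    ∃ σ, T * (‖signParam b ε σ‖ - 1 / 2)
      ≤ expectedRegret alg (gaussianInstance (signParam b ε σ)) T := by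
  have h : ∑ _σ : Fin d → ℤˣ, (0 : ℝ) ≤ ∑ σ, ∑ i, ∫ ω : History (d + 1) T, excessRegret b ε σ i ω
      ∂(historyLaw alg (gaussianInstance (signParam b ε σ)) T) := by
    rw [Finset.sum_comm, Finset.sum_const_zero]
    exact Finset.sum_nonneg fun i _ => sum_integral_excessRegret_nonneg b ε alg T hε i
  obtain ⟨σ, -, hσ⟩ := Finset.exists_le_of_sum_le Finset.univ_nonempty h
  exact ⟨σ, by linarith [le_expectedRegret_signParam b ε σ alg T]⟩

end HardInstances

/-! ### A basis starting at the hint, and the choice of constants. -/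

lemma exists_orthonormalBasis_zero_eq {d : ℕ} (h : EuclideanSpace ℝ (Fin (d + 1)))
    (hh : ‖h‖ = 1) :
    ∃ b : OrthonormalBasis (Fin (d + 1)) ℝ (EuclideanSpace ℝ (Fin (d + 1))), b 0 = h := by
  obtain ⟨b, hb⟩ := Orthonormal.exists_orthonormalBasis_extension_of_card_eq (𝕜 := ℝ)
    (E := EuclideanSpace ℝ (Fin (d + 1))) (ι := Fin (d + 1)) (by simp) (v := fun _ => h) (s := {0})
    ⟨fun _ => hh, fun i j hij => absurd (Subsingleton.elim i j) hij⟩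
  exact ⟨b, hb 0 rfl⟩

end LinBandit

end

theorem mainTheorem3 (d T : ℕ) (hT : max ((d : ℝ) ^ 2 / 2 ^ 8) (2 ^ 6) ≤ (T : ℝ))
    (Δ : ℝ) (hΔ_nonneg : 0 ≤ Δ) (hΔ : Δ ^ 2 = (d : ℝ) / (2 ^ 8 * Real.sqrt (T : ℝ)))
    (h : EuclideanSpace ℝ (Fin (d + 1))) (hh : ‖h‖ = 1)
    (alg : LinBandit.Algorithm (d + 1)) :
    ∃ B : LinBandit.Instance (d + 1),
      (∀ t, B.noise t = ProbabilityTheory.gaussianReal 0 1) ∧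
      ‖B.θ - (1 / 2 : ℝ) • h‖ ≤ Δ ∧
      ‖B.optAction - h‖ ≤ 4 * Δ ∧
      B.instRegret B.optAction h ≤ 972 * Δ ^ 2 ∧
      972 * Δ ^ 2 = 243 / 64 * ((d : ℝ) / Real.sqrt (T : ℝ)) ∧
      (d : ℝ) * Real.sqrt (T : ℝ) / 512 ≤ LinBandit.expectedRegret alg B T := by

  have hT64 : (2 : ℝ) ^ 6 ≤ T := (le_max_right _ _).trans hT
  have hTd : (d : ℝ) ^ 2 / 2 ^ 8 ≤ T := (le_max_left _ _).trans hT
  set r := Real.sqrt (T : ℝ)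
  have hr2 : r ^ 2 = T := Real.sq_sqrt (Nat.cast_nonneg T)
  have hr : 0 < r := Real.sqrt_pos.mpr (by linarith)
  have hdr : (d : ℝ) ≤ 16 * r := by
    refine (pow_le_pow_iff_left₀ (Nat.cast_nonneg d) (by positivity) two_ne_zero).mp ?_
    rw [mul_pow, hr2]
    linarith
  -- Chosen so that `d * ε ^ 2 = Δ ^ 2`; then `ε ^ 4 * T = 1 / 2 ^ 16`, far below the required `1 /
  -- 16`.
  set ε := Real.sqrt (1 / (2 ^ 8 * r))
  have hε2 : ε ^ 2 = 1 / (2 ^ 8 * r) := Real.sq_sqrt (by positivity)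
  have hε4 : ε ^ 4 * T ≤ 1 / 16 := by
    have : ε ^ 4 * T = 1 / 2 ^ 16 := by
      rw [show ε ^ 4 = (ε ^ 2) ^ 2 by ring, hε2, ← hr2]
      field_simp
    rw [this]
    norm_num
  have hdε : (d : ℝ) * ε ^ 2 = Δ ^ 2 := by rw [hΔ, hε2]; ring
  have hΔ1 : Δ ^ 2 ≤ 1 / 16 := by
    rw [hΔ, div_le_iff₀ (by positivity)]
    linarith
  obtain ⟨b, rfl⟩ := LinBandit.exists_orthonormalBasis_zero_eq h hh
  obtain ⟨σ, hσ⟩ := LinBandit.exists_signs_le_expectedRegret b ε alg T hε4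
  have hN2 := LinBandit.norm_sq_signParam b ε σ
  have hNh := LinBandit.half_le_norm_signParam b ε σ
  have hdist := LinBandit.norm_sq_signParam_sub b ε σ
  have hin := LinBandit.inner_basis_zero_signParam b ε σ
  rw [hdε] at hN2 hdist
  set θ := LinBandit.signParam b ε σ
  have hNpos : 0 < ‖θ‖ := by linarith
  have hθ : (LinBandit.gaussianInstance θ).θ ≠ 0 := norm_pos_iff.mp hNpos
  refine ⟨LinBandit.gaussianInstance θ, fun _ => rfl, ?_, ?_, ?_, ?_, ?_⟩
  · exact (pow_le_pow_iff_left₀ (norm_nonneg _) hΔ_nonneg two_ne_zero).mp hdist.le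
  · refine (pow_le_pow_iff_left₀ (norm_nonneg _) (by positivity) two_ne_zero).mp ?_
    change ‖‖θ‖⁻¹ • θ - b 0‖ ^ 2 ≤ _
    -- Both vectors have norm `1`, and their inner product is `1 / (2 * ‖θ‖)`.
    have he : ‖‖θ‖⁻¹ • θ - b 0‖ ^ 2 = 2 - ‖θ‖⁻¹ := by
      rw [norm_sub_sq_real, norm_smul, norm_inv, norm_norm, inv_mul_cancel₀ hNpos.ne',
        inner_smul_left, real_inner_comm, hin, hh]
      simp
      ring
    rw [he, sub_le_iff_le_add]
    refine (mul_le_mul_iff_left₀ hNpos).mp ?_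
    rw [add_mul, inv_mul_cancel₀ hNpos.ne']
    nlinarith [mul_nonneg (sq_nonneg Δ) hNpos.le, mul_nonneg (sq_nonneg Δ) (sub_nonneg.mpr hNh)]
  · rw [LinBandit.Instance.instRegret, LinBandit.inner_optAction _ hθ]
    change ‖θ‖ - ⟪θ, b 0⟫ ≤ _
    rw [real_inner_comm, hin]
    -- Since `‖θ‖ ^ 2 = 1 / 4 + Δ ^ 2`, even `‖θ‖ - 1 / 2 ≤ Δ ^ 2` holds; the constant `972` is
    -- generous.
    nlinarith [sq_nonneg Δ]
  · rw [hΔ]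
    ring
  · refine le_trans ?_ hσ
    have h1 : (d : ℝ) * r / 512 = T * (Δ ^ 2 / 2) := by
      rw [hΔ, ← hr2]
      field_simp
      norm_num
    rw [h1]
    refine mul_le_mul_of_nonneg_left ?_ (Nat.cast_nonneg T)
    -- After squaring this asks for `Δ ^ 4 / 4 ≤ Δ ^ 2 / 2`, which follows from `Δ ^ 2 ≤ 1 / 16`.
    have h2 : 1 / 2 + Δ ^ 2 / 2 ≤ ‖θ‖ := by
      refine (pow_le_pow_iff_left₀ (by positivity) (norm_nonneg _) two_ne_zero).mp ?_
      nlinarith [sq_nonneg Δ]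
    linarith
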